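/- **Theorem 3 (Sufficient condition for quantum advantage).** Setting. Each of $N\ge 1$ senders independently receives a uniformly random input $x_i\in[n]$ and sends a message depending on $x_i$ to a receiver, who outputs a tuple $z\in[n]^N$; the figure of merit is $\widetilde{\mathcal S}=1-\sum_{\vec x} n^{-N}\,p(z=\vec x\mid\vec x)$. In quantum communication sender $i$ prepares density matrices $\rho^{(i)}_{x}$, $x\in[n]$, on a finite-dimensional space of arbitrary dimension, the receiver measures a POVM $\{M_z\}$, and $p(z\mid\vec x)=\operatorname{Tr}\big[(\bigotimes_i\rho^{(i)}_{x_i})M_z\big]$; the anti-distinguishability of the inputs of sender $i$ is $1-\min_M\sum_z\min_x \frac1n\operatorname{Tr}(\rho^{(i)}_x M_z)$, the outer minimum being over all POVMs with finitely many outcomes. In classical communication sender $i$ encodes $x_i$ in a message $m_i$ of a finite alphabet with probability $p_e^{(i)}(m_i\mid x_i)$, the receiver decodes with probability $p_d(z\mid \vec m)$, $p(z\mid\vec x)=\sum_{\vec m}p_d(z\mid\vec m)\prod_i p^{(i)}_e(m_i\mid x_i)$, and the anti-distinguishability of the inputs of sender $i$ is $1-\sum_{m}\min_{x}\frac1n p^{(i)}_e(m\mid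 x)$. Let $\widetilde{\mathcal S}_Q(A)$ and $\widetilde{\mathcal S}_C(A)$ be the suprema of $\widetilde{\mathcal S}$ over the quantum and the classical strategies in which the anti-distinguishability of the inputs of every sender is at most $A$, and let $A^Q=\inf\{A:\widetilde{\mathcal S}_Q(A)=1\}$ and $A^C=\inf\{A:\widetilde{\mathcal S}_C(A)=1\}$. A finite family of pure states $(|\varphi_x\rangle)_x$ is called anti-distinguishable if there is a POVM $\{M_x\}$, indexed by the same set, with $\langle\varphi_x|M_x|\varphi_x\rangle=0$ for all $x$. Statement. Let $|\psi_1\rangle,\dots,|\psi_n\rangle\in\mathbb C^d$ be unit vectors with $$\sum_{j\neq l}|\langle\psi_j|\psi_l\rangle|>n(n-2)\qquad\text{and}\qquad \alpha:=\sum_{j\neq l}|\langle\psi_j|\psi_l\rangle|^2\le\frac{n^2}{2^{1/N}}-n .$$ Then the states $|\psi_1\rangle,\dots,|\psi_n\rangle$ are not anti-distinguishable, and their anti-distinguishability $A_\psi$ (for uniform inputs) is less than $1$. The Gram matrix $G$ of the $n^N$ product states $|\psi_{x_1}\rangle\otimes\cdots\otimes|\psi_{x_N}\rangle$ satisfies $\|G\|_F^2=(n+\alpha)^N$,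 and these product states are anti-distinguishable. Hence there is a quantum advantage: $\widetilde{\mathcal S}_Q(A_\psi)=1$, and this value is attained by a quantum strategy, whereas $\widetilde{\mathcal S}_C(A_\psi)<1$; moreover $A^C=1$, $A^Q<1$ and $(A^C/A^Q)^N>1$. -/

import Mathlib

open scoped ComplexOrder

namespace Multipartite

noncomputable section

/-- A quantum measurement (POVM) with outcomes in `κ` on the Hilbert space `ℂ^ι`. -/
structure POVM (κ ι : Type) [Fintype κ] [Fintype ι] [DecidableEq ι] where
  /-- the POVM element of each outcome -/
  elem : κ → Matrix ι ι ℂ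
  posSemidef : ∀ z, (elem z).PosSemidef
  sum_eq_one : ∑ z, elem z = 1

/-- Density matrices on `ℂ^ι`. -/
def IsDensityMatrix {ι : Type} [Fintype ι] (ρ : Matrix ι ι ℂ) : Prop :=
  ρ.PosSemidef ∧ ρ.trace = 1

/-- The operator `|v⟩⟨v|`. -/
def pureState {ι : Type} (v : EuclideanSpace ℂ ι) : Matrix ι ι ℂ :=
  Matrix.vecMulVec (fun a => v a) (fun a => star (v a))

/-- The probability `Tr(ρ M)` of an outcome with POVM element `M` in the state `ρ`. -/
def bornProb {ι : Type} [Fintype ι] (ρ M : Matrix ι ι ℂ) : ℝ :=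
  (ρ * M).trace.re

/-- The tensor product `ρ₁ ⊗ ⋯ ⊗ ρ_N`, a matrix over `⨂ i, ℂ^(d i)`, whose standard basis is
indexed by the tuples `(a i)` with `a i ∈ Fin (d i)`. -/
def tensorMatrix {N : ℕ} {d : Fin N → ℕ} (ρ : ∀ i, Matrix (Fin (d i)) (Fin (d i)) ℂ) :
    Matrix (∀ i, Fin (d i)) (∀ i, Fin (d i)) ℂ :=
  fun a b => ∏ i, ρ i (a i) (b i)

/-- The product vector `v₁ ⊗ ⋯ ⊗ v_N` in `(ℂ^d)^{⊗ N}`. -/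
def tensorVec {N d : ℕ} (v : Fin N → EuclideanSpace ℂ (Fin d)) :
    EuclideanSpace ℂ (Fin N → Fin d) :=
  WithLp.toLp 2 (fun a => ∏ i, v i (a i))

/-- The `n ^ N` product states `|ψ_{x₁}⟩ ⊗ ⋯ ⊗ |ψ_{x_N}⟩`. -/
def productStates {n d : ℕ} (N : ℕ) (ψ : Fin n → EuclideanSpace ℂ (Fin d)) :
    (Fin N → Fin n) → EuclideanSpace ℂ (Fin N → Fin d) :=
  fun x => tensorVec (fun i => ψ (x i))

/-- A finite family of pure states is anti-distinguishable if some measurement, with one outcome for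
each state, never returns the label of the state that was prepared. -/
def AntiDistinguishable {κ ι : Type} [Fintype κ] [Fintype ι] [DecidableEq ι]
    (φ : κ → EuclideanSpace ℂ ι) : Prop :=
  ∃ M : POVM κ ι, ∀ x, bornProb (pureState (φ x)) (M.elem x) = 0

/-- The anti-distinguishability of the inputs of one sender,
`max_M (1 - ∑_z min_x q_x Tr(ρ_x M_z))`, over all measurements with finitely many outcomes. -/
def quantumAntiDist {n : ℕ} {ι : Type} [Fintype ι] [DecidableEq ι] (q : Fin n → ℝ)
    (ρ : Fin n → Matrix ι ι ℂ) : ℝ :=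
  sSup {a : ℝ | ∃ (m : ℕ) (M : POVM (Fin m) ι),
    a = 1 - ∑ z, ⨅ x, q x * bornProb (ρ x) (M.elem z)}

/-- The success values `1 - ∑_x q_x p(z = x | x)` in the task of anti-distinguishing the distributed
input `x = (x₁, …, x_N)`, over all quantum strategies (each sender prepares states in a
finite-dimensional space of its own, the receiver measures jointly) in which the
anti-distinguishability of the inputs of every sender is at most `A`.
The senders draw their inputs independently from the distribution `q`. -/
def quantumValues (N : ℕ) {n : ℕ} (q : Fin n → ℝ) (A : ℝ) : Set ℝ :=
  {s : ℝ | ∃ (d : Fin N → ℕ) (ρ : ∀ i, Fin n → Matrix (Fin (d i)) (Fin (d i)) ℂ)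
      (M : POVM (Fin N → Fin n) (∀ i, Fin (d i))),
    (∀ i x, IsDensityMatrix (ρ i x)) ∧
    (∀ i, quantumAntiDist q (ρ i) ≤ A) ∧
    s = 1 - ∑ x : Fin N → Fin n,
      (∏ i, q (x i)) * bornProb (tensorMatrix (fun i => ρ i (x i))) (M.elem x)}

/-- `p` is a conditional probability distribution `p(b | a)`. -/
def IsStochastic {α β : Type} [Fintype β] (p : α → β → ℝ) : Prop :=
  ∀ a, (∀ b, 0 ≤ p a b) ∧ ∑ b, p a b = 1

/-- The anti-distinguishability `1 - ∑_m min_x q_x p_e(m | x)` of the inputs of one sender who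
encodes them in a classical message according to `p_e`. -/
def classicalAntiDist {n k : ℕ} (q : Fin n → ℝ) (pe : Fin n → Fin k → ℝ) : ℝ :=
  1 - ∑ m, ⨅ x, q x * pe x m

/-- The success values in the same task over all classical strategies (encodings `p_e(m_i | x_i)` of
the senders into finite alphabets, a decoding `p_d(z | m)` of the receiver) in which the
anti-distinguishability of the inputs of every sender is at most `A`. -/
def classicalValues (N : ℕ) {n : ℕ} (q : Fin n → ℝ) (A : ℝ) : Set ℝ :=
  {s : ℝ | ∃ (k : Fin N → ℕ) (pe : ∀ i, Fin n → Fin (k i) → ℝ)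
      (pd : (∀ i, Fin (k i)) → (Fin N → Fin n) → ℝ),
    (∀ i, IsStochastic (pe i)) ∧ IsStochastic pd ∧
    (∀ i, classicalAntiDist q (pe i) ≤ A) ∧
    s = 1 - ∑ x : Fin N → Fin n,
      (∏ i, q (x i)) * ∑ m : (∀ i, Fin (k i)), pd m x * ∏ i, pe i (x i) (m i)}

/-- The optimal quantum success `S̃_Q` when the anti-distinguishability of the inputs of every sender
is bounded by `A`. -/
def quantumSuccess (N : ℕ) {n : ℕ} (q : Fin n → ℝ) (A : ℝ) : ℝ :=
  sSup (quantumValues N q A)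

/-- The optimal classical success `S̃_C` when the anti-distinguishability of the inputs of every
sender is bounded by `A`. -/
def classicalSuccess (N : ℕ) {n : ℕ} (q : Fin n → ℝ) (A : ℝ) : ℝ :=
  sSup (classicalValues N q A)

/-- `A^Q`: the anti-distinguishability of the inputs of each sender that is required in quantum
communication to reach the optimal success `s`. -/
def requiredQuantum (N : ℕ) {n : ℕ} (q : Fin n → ℝ) (s : ℝ) : ℝ :=
  sInf {A : ℝ | quantumSuccess N q A = s}

/-- `A^C`: the anti-distinguishability of the inputs of each sender that is required in classical
communication to reach the optimal success `s`. -/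
def requiredClassical (N : ℕ) {n : ℕ} (q : Fin n → ℝ) (s : ℝ) : ℝ :=
  sInf {A : ℝ | classicalSuccess N q A = s}

/-- The uniform distribution on the `n` inputs of a sender. -/
def uniform (n : ℕ) : Fin n → ℝ := fun _ => 1 / (n : ℝ)

open scoped Matrix.Norms.Frobenius in
/-- The Frobenius norm of the Gram matrix `(⟨φ_x|φ_y⟩)_{x,y}`. -/
def gramFrobeniusNorm {κ ι : Type} [Fintype κ] [Fintype ι]
    (φ : κ → EuclideanSpace ℂ ι) : ℝ :=
  ‖Matrix.gram ℂ φ‖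

end

end Multipartite

open Multipartite

namespace Multipartite

/-! The quantum half rests on `antiDistinguishable_of_two_mul_sum_sq_le`: `m` unit vectors are
anti-distinguishable as soon as `2‖G‖_F² ≤ m²`. Otherwise a multiple of the identity is separated
from the sums of positive operators annihilating the respective states. The separating functional is
a Hermitian matrix `H` of negative trace whose form is positive on every `φ x`-orthogonal
hyperplane. Such an `H` has one negative eigenvalue, all others being positive, and its inverse form
is nonpositive at each `φ x`. Let `s k` be the diagonal entries of the frame operator in the
eigenbasis. Summing over `x` and applying Cauchy–Schwarz with the trace condition, `(∑ √s k)²` over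
the positive eigenvalues is less than the remaining entry `s k₀`. This concentration forces `(∑ s
k)² < 2 ∑ (s k)²`, while `∑ s k = m` and `∑ (s k)² ≤ ‖G‖_F²`, a contradiction. For product states
`‖G‖_F² = (n + α)^N` and `m = n^N`, so the bound on `α` is exactly the criterion.

For a single sender, a measurement of total error `δ` bounds the sum of the overlaps by `n(n - 2) +
2n√δ` (`sum_norm_inner_le_of_povm`). A sum above `n(n - 2)` therefore keeps `δ` away from zero and
`A_ψ` below `1`.

Classically the errors of the senders multiply: the receiver errs with probability at least `(1 -
A)^N` (`classicalValues_le`), so success `1` requires `A ≥ 1`. -/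

/-! ### Real inequalities and diagonal forms -/

/-- For nonnegative reals, `∑_{j ≠ k} a_j² a_k² ≤ (∑_{j ≠ k} a_j a_k)² / 2`, in terms of power sums. -/
lemma sq_sum_sq_sub_sum_pow_four_le {ι : Type*} (s : Finset ι) (a : ι → ℝ)
    (ha : ∀ i ∈ s, 0 ≤ a i) :
    ∑ i ∈ s, a i ^ 2 ≤ (∑ i ∈ s, a i) ^ 2 ∧
      2 * ((∑ i ∈ s, a i ^ 2) ^ 2 - ∑ i ∈ s, a i ^ 4) ≤
        ((∑ i ∈ s, a i) ^ 2 - ∑ i ∈ s, a i ^ 2) ^ 2 := by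
  classical
  induction s using Finset.induction_on with
  | empty => simp
  | insert j s hj ih =>
    obtain ⟨ih₁, ih₂⟩ := ih fun i hi => ha i (Finset.mem_insert_of_mem hi)
    have h0 : 0 ≤ a j := ha j (Finset.mem_insert_self _ _)
    have hs : 0 ≤ ∑ i ∈ s, a i :=
      Finset.sum_nonneg fun i hi => ha i (Finset.mem_insert_of_mem hi)
    simp only [Finset.sum_insert hj]
    generalize ∑ i ∈ s, a i = p at *
    generalize ∑ i ∈ s, a i ^ 2 = p₂ at *
    generalize ∑ i ∈ s, a i ^ 4 = p₄ at *
    constructor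
    · nlinarith [mul_nonneg h0 hs]
    -- Passing from `s` to `insert j s` increases the right side minus the left side by `4 a j p (p²
    -- - p₂) + 4 (a j)² (p² - p₂)`.
    · have h₁ : 0 ≤ a j * p * (p ^ 2 - p₂) := mul_nonneg (mul_nonneg h0 hs) (sub_nonneg.2 ih₁)
      have h₂ : 0 ≤ a j ^ 2 * (p ^ 2 - p₂) := mul_nonneg (sq_nonneg _) (sub_nonneg.2 ih₁)
      nlinarith

/-- If one entry `s₀` of a nonnegative vector exceeds `(∑ √s_k)²` over the other entries, then the
vector is concentrated: `(∑ s_k)² < 2 ∑ s_k²`. -/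
lemma sq_sum_lt_two_mul_sum_sq {ι : Type*} (t : Finset ι) (s : ι → ℝ) (s₀ : ℝ)
    (hs : ∀ i ∈ t, 0 ≤ s i) (h : (∑ i ∈ t, √(s i)) ^ 2 < s₀) :
    (s₀ + ∑ i ∈ t, s i) ^ 2 < 2 * (s₀ ^ 2 + ∑ i ∈ t, s i ^ 2) := by
  obtain ⟨h₁, h₂⟩ := sq_sum_sq_sub_sum_pow_four_le t (fun i => √(s i)) fun i _ => Real.sqrt_nonneg _
  have e₂ : ∑ i ∈ t, √(s i) ^ 2 = ∑ i ∈ t, s i :=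
    Finset.sum_congr rfl fun i hi => Real.sq_sqrt (hs i hi)
  have e₄ : ∑ i ∈ t, √(s i) ^ 4 = ∑ i ∈ t, s i ^ 2 :=
    Finset.sum_congr rfl fun i hi => by
      rw [show 4 = 2 * 2 from rfl, pow_mul, Real.sq_sqrt (hs i hi)]
  rw [e₂] at h₁ h₂
  rw [e₄] at h₂
  -- With `T = ∑ s i`, the claim reads `2 (T² - ∑ (s i)²) < (s₀ - T)²`. It follows from `h₂` because
  -- `s₀ > (∑ √(s i))² ≥ T`.
  nlinarith

/-- A real diagonal form with exactly one negative coefficient which is nonnegative on the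
hyperplane orthogonal to `b` has a nonpositive inverse form at `b`. -/
lemma sum_sq_div_le_of_nonneg_on_orthogonal {ι : Type*} [Fintype ι] [DecidableEq ι] (μ : ι → ℝ)
    (b : ι → ℂ) (k₀ : ι) (h₀ : μ k₀ < 0) (hμ : ∀ k, k ≠ k₀ → 0 < μ k) (hb : b k₀ ≠ 0)
    (hq : ∀ v : ι → ℂ, ∑ k, star (b k) * v k = 0 → 0 ≤ ∑ k, μ k * ‖v k‖ ^ 2) :
    ∑ k ∈ Finset.univ.erase k₀, ‖b k‖ ^ 2 / μ k ≤ ‖b k₀‖ ^ 2 / (-μ k₀) := by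
  set C : ℝ := ∑ k ∈ Finset.univ.erase k₀, ‖b k‖ ^ 2 / μ k with hC
  have hC0 : 0 ≤ C := Finset.sum_nonneg fun k hk =>
    div_nonneg (sq_nonneg _) (hμ k (Finset.ne_of_mem_erase hk)).le
  have hb' : star (b k₀) ≠ 0 := star_ne_zero.2 hb
  -- The test vector is the inverse form applied to `b` off `k₀`; its entry at `k₀` is chosen to
  -- make it orthogonal to `b`. The form takes the value `C + μ k₀ C² / ‖b k₀‖²` there.
  have key := hq (fun k => if k = k₀ then -(C : ℂ) / star (b k₀) else b k / (μ k : ℂ)) (by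
    rw [← Finset.add_sum_erase _ _ (Finset.mem_univ k₀)]
    have : ∑ k ∈ Finset.univ.erase k₀, star (b k) *
        (if k = k₀ then -(C : ℂ) / star (b k₀) else b k / (μ k : ℂ)) = (C : ℂ) := by
      rw [hC, Complex.ofReal_sum]
      refine Finset.sum_congr rfl fun k hk => ?_
      rw [if_neg (Finset.ne_of_mem_erase hk), ← mul_div_assoc, Complex.ofReal_div]
      congr 1
      have := Complex.conj_mul' (b k)
      simpa using this
    rw [this, if_pos rfl, mul_div_cancel₀ _ hb']
    ring)
  rw [← Finset.add_sum_erase _ _ (Finset.mem_univ k₀)] at key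
  have e : ∑ k ∈ Finset.univ.erase k₀, μ k *
      ‖(if k = k₀ then -(C : ℂ) / star (b k₀) else b k / (μ k : ℂ))‖ ^ 2 = C := by
    refine Finset.sum_congr rfl fun k hk => ?_
    have hk' := hμ k (Finset.ne_of_mem_erase hk)
    rw [if_neg (Finset.ne_of_mem_erase hk), norm_div, Complex.norm_real, Real.norm_eq_abs,
      abs_of_pos hk']
    field_simp
  simp only [if_true] at key
  rw [e, norm_div, norm_neg, norm_star, Complex.norm_real, Real.norm_eq_abs, abs_of_nonneg hC0,
    div_pow] at key
  have hpos : 0 < ‖b k₀‖ ^ 2 := by positivity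
  rcases hC0.eq_or_lt with h | h
  · rw [← h]
    exact div_nonneg hpos.le (by linarith)
  · rw [le_div_iff₀ (by linarith)]
    have : 0 ≤ C * (‖b k₀‖ ^ 2 + μ k₀ * C) := by
      have := mul_nonneg key hpos.le
      have e : (μ k₀ * (C ^ 2 / ‖b k₀‖ ^ 2) + C) * ‖b k₀‖ ^ 2 = C * (‖b k₀‖ ^ 2 + μ k₀ * C) := by
        field_simp
        ring
      rwa [e] at this
    have := nonneg_of_mul_nonneg_right this h
    linarith

/-! ### Frame operators and forms with one negative direction -/

section Forms

variable {κ ι : Type*} [Fintype κ] [Fintype ι]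
  {V : Type*} [NormedAddCommGroup V] [InnerProductSpace ℂ V]

/-- The diagonal entries of the frame operator of `φ` in an orthonormal basis are dominated by the
Gram matrix of `φ` in Frobenius norm. -/
lemma sum_sq_frame_diagonal_le (φ : κ → V) (w : OrthonormalBasis ι ℂ V) :
    ∑ k, (∑ x, ‖inner ℂ (w k) (φ x)‖ ^ 2) ^ 2 ≤ ∑ x, ∑ y, ‖inner ℂ (φ x) (φ y)‖ ^ 2 := by
  -- `S k` is the frame operator applied to `w k`. Its diagonal entry is at most `‖S k‖`, and `∑ ‖S
  -- k‖²` is the squared Hilbert–Schmidt norm of the frame operator, which equals that of the Gram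
  -- matrix.
  let S : ι → V := fun k => ∑ x, inner ℂ (φ x) (w k) • φ x
  have h₁ : ∀ k, ((∑ x, ‖inner ℂ (w k) (φ x)‖ ^ 2 : ℝ) : ℂ) = inner ℂ (w k) (S k) := by
    intro k
    simp only [S, inner_sum, inner_smul_right]
    push_cast
    refine Finset.sum_congr rfl fun x _ => ?_
    rw [← inner_conj_symm, RCLike.norm_conj, Complex.mul_conj']
  have h₂ : ∀ k, (∑ x, ‖inner ℂ (w k) (φ x)‖ ^ 2) ^ 2 ≤ ‖S k‖ ^ 2 := by
    intro k
    have := norm_inner_le_norm (𝕜 := ℂ) (w k) (S k)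
    rw [← h₁, Complex.norm_real, w.norm_eq_one, one_mul, Real.norm_eq_abs,
      abs_of_nonneg (Finset.sum_nonneg fun _ _ => sq_nonneg _)] at this
    exact pow_le_pow_left₀ (Finset.sum_nonneg fun _ _ => sq_nonneg _) this 2
  refine (Finset.sum_le_sum fun k _ => h₂ k).trans (le_of_eq ?_)
  have h₃ : ((∑ k, ‖S k‖ ^ 2 : ℝ) : ℂ) = ((∑ x, ∑ y, ‖inner ℂ (φ x) (φ y)‖ ^ 2 : ℝ) : ℂ) := by
    have h : ∀ k, ((‖S k‖ ^ 2 : ℝ) : ℂ) = ∑ x, ∑ y,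
        inner ℂ (φ y) (φ x) * (inner ℂ (φ x) (w k) * inner ℂ (w k) (φ y)) := by
      intro k
      rw [Complex.ofReal_pow, ← Complex.coe_algebraMap, ← inner_self_eq_norm_sq_to_K (𝕜 := ℂ)]
      simp only [S, inner_sum, sum_inner, inner_smul_left, inner_smul_right, inner_conj_symm]
      simp only [Finset.mul_sum]
      refine Finset.sum_congr rfl fun x _ => Finset.sum_congr rfl fun y _ => ?_
      ring
    rw [Complex.ofReal_sum, Finset.sum_congr rfl fun k _ => h k, Finset.sum_comm]
    push_cast
    refine Finset.sum_congr rfl fun x _ => ?_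
    rw [Finset.sum_comm]
    refine Finset.sum_congr rfl fun y _ => ?_
    rw [← Finset.mul_sum, w.sum_inner_mul_inner, ← inner_conj_symm (φ y) (φ x), Complex.conj_mul']
  exact_mod_cast h₃

/-- A diagonal form of negative trace that is positive on the orthogonal complement of every
`φ x` forces the Gram matrix of `φ` to have a large Frobenius norm. -/
lemma sq_card_lt_of_pos_on_orthogonal [Nonempty κ] (φ : κ → V) (hφ : ∀ x, ‖φ x‖ = 1)
    (w : OrthonormalBasis ι ℂ V) (μ : ι → ℝ) (htr : ∑ k, μ k < 0)
    (hq : ∀ x v, v ≠ 0 → inner ℂ (φ x) v = 0 → 0 < ∑ k, μ k * ‖inner ℂ (w k) v‖ ^ 2) :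
    (Fintype.card κ : ℝ) ^ 2 < 2 * ∑ x, ∑ y, ‖inner ℂ (φ x) (φ y)‖ ^ 2 := by
  classical
  obtain ⟨k₀, -, hk₀⟩ := Finset.exists_lt_of_sum_lt (s := Finset.univ) (f := μ) (g := fun _ => 0)
    (by simpa using htr)
  have horth : ∀ j k, inner ℂ (w j) (w k) = if j = k then (1 : ℂ) else 0 :=
    orthonormal_iff_ite.1 w.orthonormal
  have hb : ∀ x, inner ℂ (w k₀) (φ x) ≠ 0 := by
    intro x h
    have := hq x (w k₀) (w.orthonormal.ne_zero k₀) (inner_eq_zero_symm.1 h)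
    rw [Finset.sum_eq_single k₀ (fun k _ hk => by simp [horth, hk]) (by simp)] at this
    simp at this
    linarith
  have hμ : ∀ k, k ≠ k₀ → 0 < μ k := by
    intro k hk
    obtain ⟨x⟩ := ‹Nonempty κ›
    -- A vector in the plane of `w k` and `w k₀` orthogonal to `φ x`: since `μ k₀ < 0`, positivity
    -- of the form there forces `μ k > 0`.
    have h := hq x (inner ℂ (φ x) (w k₀) • w k - inner ℂ (φ x) (w k) • w k₀) (by
      intro h
      have := congrArg (inner ℂ (w k)) h
      simp [inner_sub_right, inner_smul_right, horth, hk] at this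
      exact hb x (inner_eq_zero_symm.1 this)) (by
      rw [inner_sub_right, inner_smul_right, inner_smul_right]; ring)
    rw [← Finset.add_sum_erase _ _ (Finset.mem_univ k₀),
      ← Finset.add_sum_erase _ _ (Finset.mem_erase.2 ⟨hk, Finset.mem_univ k⟩),
      Finset.sum_eq_zero (s := (Finset.univ.erase k₀).erase k)] at h
    · simp [inner_sub_right, inner_smul_right, horth, hk, hk.symm] at h
      have h1 : μ k₀ * ‖inner ℂ (φ x) (w k)‖ ^ 2 ≤ 0 :=
        mul_nonpos_of_nonpos_of_nonneg hk₀.le (sq_nonneg _)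
      exact pos_of_mul_pos_left (a := μ k) (b := ‖inner ℂ (φ x) (w k₀)‖ ^ 2)
        (by linarith) (sq_nonneg _)
    · intro j hj
      rw [Finset.mem_erase, Finset.mem_erase] at hj
      simp [inner_sub_right, inner_smul_right, horth, hj.1, hj.2.1]
  set s : ι → ℝ := fun k => ∑ x, ‖inner ℂ (w k) (φ x)‖ ^ 2 with hs
  have hs0 : ∀ k, 0 ≤ s k := fun k => Finset.sum_nonneg fun _ _ => sq_nonneg _
  have hsk₀ : 0 < s k₀ := Finset.sum_pos (fun x _ => by
    have := norm_pos_iff.2 (hb x)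
    positivity) Finset.univ_nonempty
  have hinv : ∑ k ∈ Finset.univ.erase k₀, s k / μ k ≤ s k₀ / (-μ k₀) := by
    simp only [hs, Finset.sum_div]
    rw [Finset.sum_comm]
    refine Finset.sum_le_sum fun x _ => ?_
    refine sum_sq_div_le_of_nonneg_on_orthogonal μ (fun k => inner ℂ (w k) (φ x)) k₀ hk₀ hμ (hb x) ?_
    intro v hv
    have hcoord : ∀ k, inner ℂ (w k) (∑ j, v j • w j) = v k := by
      intro k
      simp [inner_sum, inner_smul_right, horth]
    by_cases h0 : ∑ j, v j • w j = 0
    · refine (Finset.sum_eq_zero fun k _ => ?_).ge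
      rw [← hcoord k, h0]
      simp
    · have := hq x (∑ j, v j • w j) h0 (by
        rw [← hv, inner_sum]
        refine Finset.sum_congr rfl fun k _ => ?_
        rw [inner_smul_right, ← inner_conj_symm, mul_comm]
        simp)
      simp only [hcoord] at this
      exact this.le
  -- Cauchy–Schwarz for `√(s k) = √(s k / μ k) · √(μ k)`. The first factor is controlled by `hinv`,
  -- the second by the negative trace: `∑ μ k < -μ k₀` off `k₀`.
  have hCS : (∑ k ∈ Finset.univ.erase k₀, √(s k)) ^ 2 ≤
      (∑ k ∈ Finset.univ.erase k₀, s k / μ k) * ∑ k ∈ Finset.univ.erase k₀, μ k := by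
    refine Finset.sum_sq_le_sum_mul_sum_of_sq_le_mul _ (fun k hk => ?_) (fun k hk => ?_)
      fun k hk => ?_
    · exact div_nonneg (hs0 k) (hμ k (Finset.ne_of_mem_erase hk)).le
    · exact (hμ k (Finset.ne_of_mem_erase hk)).le
    · rw [Real.sq_sqrt (hs0 k), div_mul_cancel₀ _ (hμ k (Finset.ne_of_mem_erase hk)).ne']
  rw [← Finset.add_sum_erase _ _ (Finset.mem_univ k₀)] at htr
  have hlt : (∑ k ∈ Finset.univ.erase k₀, √(s k)) ^ 2 < s k₀ := by
    have hm : 0 ≤ ∑ k ∈ Finset.univ.erase k₀, μ k :=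
      Finset.sum_nonneg fun k hk => (hμ k (Finset.ne_of_mem_erase hk)).le
    calc _ ≤ _ := hCS
      _ ≤ s k₀ / (-μ k₀) * ∑ k ∈ Finset.univ.erase k₀, μ k := mul_le_mul_of_nonneg_right hinv hm
      _ < s k₀ / (-μ k₀) * (-μ k₀) :=
        mul_lt_mul_of_pos_left (by linarith) (div_pos hsk₀ (by linarith))
      _ = s k₀ := div_mul_cancel₀ _ (by linarith)
  have hfin := sq_sum_lt_two_mul_sum_sq (Finset.univ.erase k₀) s (s k₀) (fun k _ => hs0 k) hlt
  rw [Finset.add_sum_erase _ s (Finset.mem_univ k₀),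
    Finset.add_sum_erase _ (fun k => s k ^ 2) (Finset.mem_univ k₀)] at hfin
  have htot : ∑ k, s k = Fintype.card κ := by
    simp only [hs]
    rw [Finset.sum_comm]
    simp [w.sum_sq_norm_inner_right, hφ]
  rw [htot] at hfin
  have := sum_sq_frame_diagonal_le φ w
  linarith

end Forms

/-! ### Anti-distinguishability by separation of convex sets -/

section

variable {κ ι : Type} [Fintype κ] [Fintype ι]

lemma trace_pureState_mul (v : EuclideanSpace ℂ ι) (M : Matrix ι ι ℂ) :
    (pureState v * M).trace = star (v : ι → ℂ) ⬝ᵥ (M.mulVec v) := by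
  rw [pureState, Matrix.trace_mul_comm, Matrix.mul_vecMulVec, Matrix.trace_vecMulVec,
    dotProduct_comm]
  rfl

lemma bornProb_pureState (v : EuclideanSpace ℂ ι) (M : Matrix ι ι ℂ) :
    bornProb (pureState v) M = (star (v : ι → ℂ) ⬝ᵥ (M.mulVec v)).re := by
  rw [bornProb, trace_pureState_mul]

lemma posSemidef_pureState (v : EuclideanSpace ℂ ι) : (pureState v).PosSemidef :=
  Matrix.posSemidef_vecMulVec_self_star _

lemma trace_pureState (v : EuclideanSpace ℂ ι) : (pureState v).trace = (‖v‖ ^ 2 : ℝ) := by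
  rw [pureState, Matrix.trace_vecMulVec, EuclideanSpace.norm_sq_eq]
  push_cast
  exact Finset.sum_congr rfl fun a _ => Complex.mul_conj' (v a)

lemma isDensityMatrix_pureState {v : EuclideanSpace ℂ ι} (hv : ‖v‖ = 1) :
    IsDensityMatrix (pureState v) :=
  ⟨posSemidef_pureState v, by simp [trace_pureState, hv]⟩

open scoped MatrixOrder in
lemma exists_eq_conjTranspose_mul_self {M : Matrix ι ι ℂ} (hM : M.PosSemidef) :
    ∃ B : Matrix ι ι ℂ, M = B.conjTranspose * B := by
  classical
  exact CStarAlgebra.nonneg_iff_eq_star_mul_self.1 hM.nonneg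

lemma bornProb_nonneg {ρ M : Matrix ι ι ℂ} (hρ : ρ.PosSemidef) (hM : M.PosSemidef) :
    0 ≤ bornProb ρ M := by
  obtain ⟨B, rfl⟩ := exists_eq_conjTranspose_mul_self hρ
  rw [bornProb, Matrix.mul_assoc, Matrix.trace_mul_comm]
  exact (Complex.le_def.1 (hM.mul_mul_conjTranspose_same B).trace_nonneg).1

lemma isClosed_setOf_posSemidef : IsClosed {M : Matrix ι ι ℂ | M.PosSemidef} := by
  simp only [Matrix.posSemidef_iff_dotProduct_mulVec, Set.ofPred_and, Set.ofPred_forall]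
  refine IsClosed.inter (isClosed_eq (by fun_prop) continuous_id) (isClosed_iInter fun v => ?_)
  exact isClosed_le continuous_const (by fun_prop)

/-- The families of positive semidefinite matrices of total trace one whose member with label `x`
annihilates `φ x`. -/
def annihilatingFamilies (φ : κ → EuclideanSpace ℂ ι) : Set (κ → Matrix ι ι ℂ) :=
  {M | (∀ x, (M x).PosSemidef ∧ bornProb (pureState (φ x)) (M x) = 0) ∧ ∑ x, (M x).trace = 1}

lemma convex_annihilatingFamilies (φ : κ → EuclideanSpace ℂ ι) :
    Convex ℝ (annihilatingFamilies φ) := by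
  intro M hM M' hM' a b ha hb hab
  refine ⟨fun x => ⟨((hM.1 x).1.smul ha).add ((hM'.1 x).1.smul hb), ?_⟩, ?_⟩
  · have h := (hM.1 x).2
    have h' := (hM'.1 x).2
    simp only [bornProb] at h h' ⊢
    simp [Matrix.mul_add, h, h']
  · simp only [Pi.add_apply, Pi.smul_apply, Matrix.trace_add, Matrix.trace_smul,
      Finset.sum_add_distrib, ← Finset.smul_sum, hM.2, hM'.2]
    rw [← add_smul, hab, one_smul]

lemma isCompact_annihilatingFamilies (φ : κ → EuclideanSpace ℂ ι) :
    IsCompact (annihilatingFamilies φ) := by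
  -- Total trace one means that the squared entries of the factors `B x` in `M x = (B x)ᴴ (B x)` sum
  -- to one, so the families lie in the continuous image of a ball.
  have hK : IsCompact ((fun (B : κ → ι → ι → ℂ) (x : κ) =>
      ((Matrix.of (B x)).conjTranspose * Matrix.of (B x) : Matrix ι ι ℂ)) ''
        Metric.closedBall 0 1) := by
    refine (isCompact_closedBall 0 1).image ?_
    refine continuous_pi fun x => ?_
    have : Continuous fun B : κ → ι → ι → ℂ => (Matrix.of (B x) : Matrix ι ι ℂ) :=
      continuous_apply x
    exact this.matrix_conjTranspose.matrix_mul this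
  refine hK.of_isClosed_subset ?_ ?_
  · simp only [annihilatingFamilies, Set.ofPred_and, Set.ofPred_forall]
    refine IsClosed.inter (isClosed_iInter fun x => IsClosed.inter ?_ ?_) ?_
    · exact isClosed_setOf_posSemidef.preimage (f := fun M : κ → Matrix ι ι ℂ => M x)
        (continuous_apply x)
    · unfold bornProb
      exact isClosed_eq (by fun_prop) continuous_const
    · exact isClosed_eq (by fun_prop) continuous_const
  · intro M hM
    choose B hB using fun x => exists_eq_conjTranspose_mul_self (hM.1 x).1
    refine ⟨fun x => Matrix.of.symm (B x), ?_, ?_⟩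
    · have htr : ∑ x, ∑ a, ∑ b, ‖B x b a‖ ^ 2 = 1 := by
        have := hM.2
        have h : ∀ x, (M x).trace = ((∑ a, ∑ b, ‖B x b a‖ ^ 2 : ℝ) : ℂ) := by
          intro x
          rw [hB x]
          simp [Matrix.trace, Matrix.mul_apply, Complex.conj_mul']
        simp only [h] at this
        exact_mod_cast this
      simp only [mem_closedBall_zero_iff, pi_norm_le_iff_of_nonneg zero_le_one]
      intro x b a
      change ‖B x b a‖ ≤ 1
      have h₁ : ‖B x b a‖ ^ 2 ≤ 1 := by
        rw [← htr]
        refine le_trans ?_ (Finset.single_le_sum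
          (f := fun x => ∑ a, ∑ b, ‖B x b a‖ ^ 2) (fun _ _ => by positivity) (Finset.mem_univ x))
        refine le_trans ?_ (Finset.single_le_sum
          (f := fun a => ∑ b, ‖B x b a‖ ^ 2) (fun _ _ => by positivity) (Finset.mem_univ a))
        exact Finset.single_le_sum
          (f := fun b => ‖B x b a‖ ^ 2) (fun _ _ => by positivity) (Finset.mem_univ b)
      exact (sq_le_one_iff₀ (norm_nonneg _)).1 h₁
    · funext x
      exact (hB x).symm

/-- If the normalized identity is not a sum of operators annihilating the respective states, some
Hermitian matrix of negative trace is positive on the orthogonal complement of each state. -/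
lemma exists_isHermitian_of_not_antiDistinguishable [DecidableEq ι] [Nonempty ι]
    (φ : κ → EuclideanSpace ℂ ι) (h : ¬ AntiDistinguishable φ) :
    ∃ H : Matrix ι ι ℂ, H.IsHermitian ∧ H.trace.re < 0 ∧
      ∀ x (v : EuclideanSpace ℂ ι), v ≠ 0 → inner ℂ (φ x) v = 0 →
        0 < bornProb (pureState v) H := by
  classical
  set D : ℝ := (Fintype.card ι : ℝ) with hD
  have hD0 : 0 < D := by simp [hD, Fintype.card_pos]
  let L : (κ → Matrix ι ι ℂ) →ₗ[ℝ] Matrix ι ι ℂ := ∑ x, LinearMap.proj x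
  have hL : ∀ M, L M = ∑ x, M x := fun M => by simp [L]
  have hLc : Continuous L := by
    have : (L : (κ → Matrix ι ι ℂ) → Matrix ι ι ℂ) = fun M => ∑ x, M x := funext hL
    rw [this]
    fun_prop
  -- The factor `D⁻¹` matches the normalization to total trace one; rescaling by `D` would give a
  -- POVM.
  have hnot : (D⁻¹ : ℝ) • (1 : Matrix ι ι ℂ) ∉ L '' annihilatingFamilies φ := by
    rintro ⟨M, hM, hM1⟩
    refine h ⟨⟨fun x => D • M x, fun x => (hM.1 x).1.smul hD0.le, ?_⟩, fun x => ?_⟩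
    · rw [← Finset.smul_sum, ← hL, hM1, smul_smul, mul_inv_cancel₀ hD0.ne', one_smul]
    · have := (hM.1 x).2
      simp only [bornProb] at this ⊢
      simp [this]
  have : LocallyConvexSpace ℝ (Matrix ι ι ℂ) :=
    inferInstanceAs (LocallyConvexSpace ℝ (ι → ι → ℂ))
  obtain ⟨f, u, hf₁, hf₂⟩ := RCLike.geometric_hahn_banach_point_closed (𝕜 := ℂ)
    ((convex_annihilatingFamilies φ).linear_image L)
    ((isCompact_annihilatingFamilies φ).image hLc).isClosed hnot
  let Y : Matrix ι ι ℂ := Matrix.of fun b a => f (Matrix.single a b 1)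
  have hY : ∀ M, f M = (M * Y).trace := by
    intro M
    conv_lhs => rw [Matrix.matrix_eq_sum_single M]
    simp only [map_sum, Matrix.trace, Matrix.diag_apply, Matrix.mul_apply]
    refine Finset.sum_congr rfl fun a _ => Finset.sum_congr rfl fun b _ => ?_
    rw [← mul_one (M a b), ← smul_eq_mul, ← Matrix.smul_single, map_smul]
    simp [Y]
  have hstar : ∀ P : Matrix ι ι ℂ, P.IsHermitian →
      (P * Y.conjTranspose).trace.re = (P * Y).trace.re := by
    intro P hP
    have : P * Y.conjTranspose = (Y * P).conjTranspose := by
      rw [Matrix.conjTranspose_mul, hP.eq]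
    rw [this, Matrix.trace_conjTranspose, Matrix.trace_mul_comm]
    rfl
  -- The Hermitian part of `Y` gives the same real values on Hermitian matrices; subtracting `u`
  -- times the identity moves the separating threshold to zero at trace one.
  let H : Matrix ι ι ℂ := (1 / 2 : ℝ) • (Y + Y.conjTranspose) - u • 1
  have hH : ∀ P : Matrix ι ι ℂ, P.IsHermitian →
      (P * H).trace.re = (f P).re - u * P.trace.re := by
    intro P hP
    simp only [H, Matrix.mul_sub, Matrix.mul_smul, Matrix.mul_add, Matrix.trace_sub,
      Matrix.trace_smul, Matrix.trace_add, Complex.sub_re, Complex.real_smul, Complex.re_ofReal_mul,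
      Complex.add_re, hstar P hP, hY P, Matrix.mul_one]
    ring
  refine ⟨H, ?_, ?_, fun x v hv hxv => ?_⟩
  · simp only [H, Matrix.IsHermitian, Matrix.conjTranspose_sub, Matrix.conjTranspose_smul,
      Matrix.conjTranspose_add, Matrix.conjTranspose_conjTranspose, Matrix.conjTranspose_one,
      star_trivial, add_comm]
  · have h₁ := hH 1 Matrix.isHermitian_one
    rw [Matrix.one_mul] at h₁
    rw [h₁, Matrix.trace_one, Complex.natCast_re, ← hD]
    have h₂ : (f ((D⁻¹ : ℝ) • (1 : Matrix ι ι ℂ))).re = D⁻¹ * (f 1).re := by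
      rw [← Complex.coe_smul, map_smul, smul_eq_mul, Complex.re_ofReal_mul]
    have h₃ : D⁻¹ * (f 1).re < u := h₂ ▸ hf₁
    rw [inv_mul_lt_iff₀ hD0] at h₃
    linarith
  · have hv0 : 0 < ‖v‖ ^ 2 := by
      have := norm_pos_iff.2 hv
      positivity
    -- The family concentrated at the label `x`, with the normalized projector on `v` as its only
    -- nonzero member, annihilates every state because `v` is orthogonal to `φ x`.
    have hmem : ((‖v‖ ^ 2)⁻¹ : ℝ) • pureState v ∈ L '' annihilatingFamilies φ := by
      refine ⟨Pi.single x (((‖v‖ ^ 2)⁻¹ : ℝ) • pureState v), ⟨fun y => ?_, ?_⟩, ?_⟩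
      · rcases eq_or_ne y x with rfl | hy
        · rw [Pi.single_eq_same]
          refine ⟨(posSemidef_pureState v).smul (inv_nonneg.2 hv0.le), ?_⟩
          have h0 : star (v : ι → ℂ) ⬝ᵥ (φ y : ι → ℂ) = 0 := by
            rw [dotProduct_comm, ← EuclideanSpace.inner_eq_star_dotProduct]
            exact inner_eq_zero_symm.1 hxv
          rw [bornProb_pureState, Matrix.smul_mulVec, pureState, Matrix.vecMulVec_mulVec]
          have h1 : (fun a => star (v a)) ⬝ᵥ (φ y : ι → ℂ) = 0 := h0
          rw [h1]
          simp
        · rw [Pi.single_eq_of_ne hy]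
          exact ⟨Matrix.PosSemidef.zero, by simp [bornProb]⟩
      · rw [Finset.sum_eq_single x (fun y _ hy => by simp [Pi.single_eq_of_ne hy]) (by simp),
          Pi.single_eq_same, Matrix.trace_smul, trace_pureState, Complex.real_smul,
          ← Complex.ofReal_mul, inv_mul_cancel₀ hv0.ne', Complex.ofReal_one]
      · rw [hL, Finset.sum_pi_single']
        simp
    have h₁ := hf₂ _ hmem
    have h₂ : (f (((‖v‖ ^ 2)⁻¹ : ℝ) • pureState v)).re = (‖v‖ ^ 2)⁻¹ * (f (pureState v)).re := by
      rw [← Complex.coe_smul, map_smul, smul_eq_mul, Complex.re_ofReal_mul]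
    have h₃ : u < (‖v‖ ^ 2)⁻¹ * (f (pureState v)).re := h₂ ▸ h₁
    rw [lt_inv_mul_iff₀ hv0] at h₃
    rw [bornProb, hH _ (posSemidef_pureState v).isHermitian, trace_pureState, Complex.ofReal_re]
    linarith

lemma bornProb_pureState_eq_sum_eigenvalues [DecidableEq ι] {H : Matrix ι ι ℂ} (hH : H.IsHermitian)
    (v : EuclideanSpace ℂ ι) :
    bornProb (pureState v) H =
      ∑ k, hH.eigenvalues k * ‖inner ℂ (hH.eigenvectorBasis k) v‖ ^ 2 := by
  have hT := Matrix.isSymmetric_toEuclideanLin_iff.2 hH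
  have he : ∀ k, Matrix.toEuclideanLin H (hH.eigenvectorBasis k) =
      (hH.eigenvalues k : ℂ) • hH.eigenvectorBasis k := by
    intro k
    apply WithLp.ofLp_injective
    simpa using hH.mulVec_eigenvectorBasis k
  have h₁ : star (v : ι → ℂ) ⬝ᵥ H.mulVec v = inner ℂ v (Matrix.toEuclideanLin H v) := by
    rw [EuclideanSpace.inner_eq_star_dotProduct, dotProduct_comm]
    rfl
  rw [bornProb_pureState, h₁, ← hH.eigenvectorBasis.sum_inner_mul_inner, Complex.re_sum]
  refine Finset.sum_congr rfl fun k _ => ?_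
  rw [← hT, he, inner_smul_left, Complex.conj_ofReal, ← inner_conj_symm, mul_left_comm,
    Complex.conj_mul', ← Complex.ofReal_pow, ← Complex.ofReal_mul, Complex.ofReal_re]

/-- **Sufficient condition for anti-distinguishability**: pure states whose Gram matrix `G`
satisfies `‖G‖_F² ≤ m² / 2`, with `m` the number of states, are anti-distinguishable. -/
theorem antiDistinguishable_of_two_mul_sum_sq_le [DecidableEq ι] [Nonempty κ]
    (φ : κ → EuclideanSpace ℂ ι)
    (hφ : ∀ x, ‖φ x‖ = 1)
    (hG : 2 * ∑ x, ∑ y, ‖inner ℂ (φ x) (φ y)‖ ^ 2 ≤ (Fintype.card κ : ℝ) ^ 2) :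
    AntiDistinguishable φ := by
  by_contra h
  have : Nonempty ι := by
    by_contra hι
    rw [not_nonempty_iff] at hι
    obtain ⟨x⟩ := ‹Nonempty κ›
    have := hφ x
    rw [Subsingleton.elim (φ x) 0, norm_zero] at this
    exact zero_ne_one this
  obtain ⟨H, hH, htr, hpos⟩ := exists_isHermitian_of_not_antiDistinguishable φ h
  refine absurd hG (not_le.2 (sq_card_lt_of_pos_on_orthogonal φ hφ hH.eigenvectorBasis
    hH.eigenvalues ?_ ?_))
  · rw [hH.trace_eq_sum_eigenvalues] at htr
    simpa using htr
  · intro x v hv hxv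
    rw [← bornProb_pureState_eq_sum_eigenvalues hH v]
    exact hpos x v hv hxv

end

/-! ### Product states and their Gram matrix -/

section Tensor

lemma inner_tensorVec {N d : ℕ} (v w : Fin N → EuclideanSpace ℂ (Fin d)) :
    inner ℂ (tensorVec v) (tensorVec w) = ∏ i, inner ℂ (v i) (w i) := by
  simp only [PiLp.inner_apply, tensorVec, RCLike.inner_apply, map_prod, ← Finset.prod_mul_distrib]
  rw [Finset.prod_univ_sum, Fintype.piFinset_univ]

lemma norm_tensorVec {N d : ℕ} {v : Fin N → EuclideanSpace ℂ (Fin d)} (hv : ∀ i, ‖v i‖ = 1) :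
    ‖tensorVec v‖ = 1 := by
  have h := inner_self_eq_norm_sq_to_K (𝕜 := ℂ) (tensorVec v)
  rw [inner_tensorVec] at h
  simp only [inner_self_eq_norm_sq_to_K, hv] at h
  have h' : (1 : ℝ) = ‖tensorVec v‖ ^ 2 := by
    apply Complex.ofReal_injective
    simpa using h
  exact (sq_eq_sq₀ (norm_nonneg _) zero_le_one).1 (by rw [← h', one_pow])

lemma tensorMatrix_pureState {N d : ℕ} (v : Fin N → EuclideanSpace ℂ (Fin d)) :
    tensorMatrix (d := fun _ => d) (fun i => pureState (v i)) = pureState (tensorVec v) := by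
  ext a b
  simp [tensorMatrix, pureState, tensorVec, Matrix.vecMulVec_apply, Finset.prod_mul_distrib]

lemma posSemidef_tensorMatrix {N : ℕ} {d : Fin N → ℕ}
    {ρ : ∀ i, Matrix (Fin (d i)) (Fin (d i)) ℂ} (hρ : ∀ i, (ρ i).PosSemidef) :
    (tensorMatrix ρ).PosSemidef := by
  choose B hB using fun i => exists_eq_conjTranspose_mul_self (hρ i)
  have : tensorMatrix ρ = (tensorMatrix B).conjTranspose * tensorMatrix B := by
    ext a b
    have h : ∀ i, ρ i (a i) (b i) = ∑ c, star (B i c (a i)) * B i c (b i) := fun i => by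
      rw [hB i]
      simp [Matrix.mul_apply]
    simp only [tensorMatrix, h, Matrix.mul_apply, Matrix.conjTranspose_apply, star_prod,
      ← Finset.prod_mul_distrib]
    rw [Finset.prod_univ_sum, Fintype.piFinset_univ]
  rw [this]
  exact Matrix.posSemidef_conjTranspose_mul_self _

/-- The squared overlaps of the product states sum to the `N`-th power of those of the factors. -/
lemma sum_sq_norm_inner_productStates {n d : ℕ} (N : ℕ) (ψ : Fin n → EuclideanSpace ℂ (Fin d)) :
    ∑ x, ∑ y, ‖inner ℂ (productStates N ψ x) (productStates N ψ y)‖ ^ 2 =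
      (∑ j, ∑ l, ‖inner ℂ (ψ j) (ψ l)‖ ^ 2) ^ N := by
  simp only [productStates, inner_tensorVec, norm_prod, ← Finset.prod_pow]
  have h : ∀ x : Fin N → Fin n, ∑ y : Fin N → Fin n, ∏ i, ‖inner ℂ (ψ (x i)) (ψ (y i))‖ ^ 2 =
      ∏ i, ∑ l, ‖inner ℂ (ψ (x i)) (ψ l)‖ ^ 2 := by
    intro x
    rw [Finset.prod_univ_sum, Fintype.piFinset_univ]
  simp only [h]
  rw [← Fin.prod_const, Finset.prod_univ_sum, Fintype.piFinset_univ]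

open scoped Matrix.Norms.Frobenius in
lemma gramFrobeniusNorm_sq {κ ι : Type} [Fintype κ] [Fintype ι] (φ : κ → EuclideanSpace ℂ ι) :
    gramFrobeniusNorm φ ^ 2 = ∑ x, ∑ y, ‖inner ℂ (φ x) (φ y)‖ ^ 2 := by
  rw [gramFrobeniusNorm, Matrix.frobenius_norm_def, ← Real.sqrt_eq_rpow, Real.sq_sqrt (by positivity)]
  simp [Matrix.gram_apply]

lemma sum_sum_eq_card_add_offDiag {n d : ℕ} {ψ : Fin n → EuclideanSpace ℂ (Fin d)}
    (hψ : ∀ x, ‖ψ x‖ = 1) :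
    ∑ j, ∑ l, ‖inner ℂ (ψ j) (ψ l)‖ ^ 2 = (n : ℝ) +
      ∑ j, ∑ l ∈ Finset.univ.filter (fun l => l ≠ j), ‖inner ℂ (ψ j) (ψ l)‖ ^ 2 := by
  have h : ∀ j, ∑ l, ‖inner ℂ (ψ j) (ψ l)‖ ^ 2 =
      1 + ∑ l ∈ Finset.univ.filter (fun l => l ≠ j), ‖inner ℂ (ψ j) (ψ l)‖ ^ 2 := by
    intro j
    rw [Finset.filter_ne', ← Finset.add_sum_erase _ _ (Finset.mem_univ j),
      inner_self_eq_norm_sq_to_K, hψ]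
    simp
  simp [h, Finset.sum_add_distrib]

end Tensor

/-! ### Overlaps against the error of a measurement -/

section Overlap

variable {ι : Type} [Fintype ι] [DecidableEq ι]

lemma sum_bornProb {κ : Type} [Fintype κ] (M : POVM κ ι) (ρ : Matrix ι ι ℂ) :
    ∑ z, bornProb ρ (M.elem z) = ρ.trace.re := by
  simp only [bornProb]
  rw [← Complex.re_sum, ← Matrix.trace_sum, ← Finset.mul_sum, M.sum_eq_one, Matrix.mul_one]

/-- Cauchy–Schwarz for the form of a positive semidefinite matrix. -/
lemma norm_star_dotProduct_mulVec_le {M : Matrix ι ι ℂ} (hM : M.PosSemidef)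
    (v w : EuclideanSpace ℂ ι) :
    ‖star (v : ι → ℂ) ⬝ᵥ M.mulVec w‖ ≤
      √(bornProb (pureState v) M) * √(bornProb (pureState w) M) := by
  obtain ⟨B, rfl⟩ := exists_eq_conjTranspose_mul_self hM
  have h : ∀ v w : EuclideanSpace ℂ ι, star (v : ι → ℂ) ⬝ᵥ (B.conjTranspose * B).mulVec w =
      inner ℂ (Matrix.toEuclideanLin B v) (Matrix.toEuclideanLin B w) := by
    intro v w
    rw [← Matrix.mulVec_mulVec, Matrix.dotProduct_mulVec, Matrix.vecMul_conjTranspose, star_star,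
      EuclideanSpace.inner_eq_star_dotProduct, dotProduct_comm]
    rfl
  have h' : ∀ v : EuclideanSpace ℂ ι, √(bornProb (pureState v) (B.conjTranspose * B)) =
      ‖Matrix.toEuclideanLin B v‖ := by
    intro v
    rw [bornProb_pureState, h, inner_self_eq_norm_sq_to_K]
    norm_cast
    exact Real.sqrt_sq (norm_nonneg _)
  rw [h, h', h']
  exact norm_inner_le_norm _ _

/-- Inserting the resolution of the identity `∑ z, M.elem z = 1` splits the overlap into forms to
which Cauchy–Schwarz applies. -/
lemma norm_inner_le_sum_sqrt {κ : Type} [Fintype κ] (M : POVM κ ι) (v w : EuclideanSpace ℂ ι) :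
    ‖inner ℂ v w‖ ≤
      ∑ z, √(bornProb (pureState v) (M.elem z)) * √(bornProb (pureState w) (M.elem z)) := by
  have h : inner ℂ v w = ∑ z, star (v : ι → ℂ) ⬝ᵥ (M.elem z).mulVec w := by
    rw [← dotProduct_sum, ← Matrix.sum_mulVec, M.sum_eq_one, Matrix.one_mulVec,
      EuclideanSpace.inner_eq_star_dotProduct, dotProduct_comm]
  rw [h]
  exact (norm_sum_le _ _).trans (Finset.sum_le_sum fun z _ =>
    norm_star_dotProduct_mulVec_le (M.posSemidef z) v w)

/-- Off-diagonal products of `n` numbers, in terms of one of them. -/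
lemma sum_offDiag_mul_le {n : ℕ} (r : Fin n → ℝ) (j₀ : Fin n) :
    ∑ j, ∑ l ∈ Finset.univ.filter (fun l => l ≠ j), r j * r l ≤
      ((n : ℝ) - 2) * ∑ j, r j ^ 2 + 2 * (r j₀ * ∑ j, r j) := by
  have h₁ : ∑ j, ∑ l ∈ Finset.univ.filter (fun l => l ≠ j), r j * r l =
      (∑ j, r j) ^ 2 - ∑ j, r j ^ 2 := by
    rw [sq, Finset.sum_mul_sum, ← Finset.sum_sub_distrib]
    refine Finset.sum_congr rfl fun j _ => ?_
    rw [Finset.filter_ne', ← Finset.add_sum_erase _ _ (Finset.mem_univ j)]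
    ring
  have h₂ : (∑ j ∈ Finset.univ.erase j₀, r j) ^ 2 ≤
      ((n : ℝ) - 1) * ∑ j ∈ Finset.univ.erase j₀, r j ^ 2 := by
    have := sq_sum_le_card_mul_sum_sq (s := Finset.univ.erase j₀) (f := r)
    rwa [Finset.card_erase_of_mem (Finset.mem_univ _), Finset.card_univ, Fintype.card_fin,
      Nat.cast_sub (Nat.one_le_of_lt j₀.2), Nat.cast_one] at this
  have e₁ := Finset.add_sum_erase Finset.univ r (Finset.mem_univ j₀)
  have e₂ := Finset.add_sum_erase Finset.univ (fun j => r j ^ 2) (Finset.mem_univ j₀)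
  have hn : (1 : ℝ) ≤ n := by exact_mod_cast Nat.one_le_of_lt j₀.2
  rw [h₁, ← e₁, ← e₂]
  -- Cauchy–Schwarz on the `n - 1` entries other than `j₀` leaves a slack of `n (r j₀)²`.
  nlinarith [mul_nonneg (sub_nonneg.2 hn) (sq_nonneg (r j₀)), sq_nonneg (r j₀)]

/-- If a measurement almost anti-distinguishes `n` pure states, with total error `δ`, then their
overlaps sum to at most `n (n - 2) + 2 n √δ`. -/
lemma sum_norm_inner_le_of_povm {n : ℕ} [NeZero n] {κ : Type} [Fintype κ]
    (ψ : Fin n → EuclideanSpace ℂ ι) (hψ : ∀ x, ‖ψ x‖ = 1) (M : POVM κ ι) :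
    ∑ j, ∑ l ∈ Finset.univ.filter (fun l => l ≠ j), ‖inner ℂ (ψ j) (ψ l)‖ ≤
      (n : ℝ) * ((n : ℝ) - 2) +
        2 * (n * √(∑ z, ⨅ x, bornProb (pureState (ψ x)) (M.elem z))) := by
  set a : Fin n → κ → ℝ := fun j z => bornProb (pureState (ψ j)) (M.elem z) with ha
  have ha0 : ∀ j z, 0 ≤ a j z := fun j z =>
    bornProb_nonneg (posSemidef_pureState _) (M.posSemidef z)
  have hsum : ∑ z, ∑ j, a j z = n := by
    rw [Finset.sum_comm]
    simp [ha, sum_bornProb, trace_pureState, hψ]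
  -- For each outcome, the state least likely to produce it is singled out, so that the correction
  -- term carries the error of that outcome.
  choose j₀ hj₀ using fun z => exists_eq_ciInf_of_finite (f := fun x => a x z)
  have hz : ∀ z, ∑ j, ∑ l ∈ Finset.univ.filter (fun l => l ≠ j), √(a j z) * √(a l z) ≤
      ((n : ℝ) - 2) * ∑ j, a j z + 2 * (√(⨅ x, a x z) * ∑ j, √(a j z)) := by
    intro z
    have := sum_offDiag_mul_le (fun j => √(a j z)) (j₀ z)
    rw [hj₀] at this
    simpa only [Real.sq_sqrt (ha0 _ _)] using this
  have hCS : ∑ z, √(⨅ x, a x z) * ∑ j, √(a j z) ≤ n * √(∑ z, ⨅ x, a x z) := by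
    have h₁ := Finset.sum_mul_sq_le_sq_mul_sq Finset.univ (fun z => √(⨅ x, a x z))
      (fun z => ∑ j, √(a j z))
    have h₂ : ∑ z, (∑ j, √(a j z)) ^ 2 ≤ (n : ℝ) ^ 2 := by
      calc ∑ z, (∑ j, √(a j z)) ^ 2 ≤ ∑ z, (n : ℝ) * ∑ j, a j z := by
            refine Finset.sum_le_sum fun z _ => ?_
            have := sq_sum_le_card_mul_sum_sq (s := Finset.univ) (f := fun j => √(a j z))
            simpa only [Real.sq_sqrt (ha0 _ _), Finset.card_univ, Fintype.card_fin] using this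
        _ = (n : ℝ) ^ 2 := by rw [← Finset.mul_sum, hsum, sq]
    have h₀ : ∀ z, 0 ≤ ⨅ x, a x z := fun z => Real.iInf_nonneg fun x => ha0 x z
    simp only [Real.sq_sqrt (h₀ _)] at h₁
    refine abs_le_of_sq_le_sq' ?_ (by positivity) |>.2
    rw [mul_pow, Real.sq_sqrt (Finset.sum_nonneg fun z _ => h₀ z), mul_comm]
    exact h₁.trans (mul_le_mul_of_nonneg_left h₂ (Finset.sum_nonneg fun z _ => h₀ z))
  calc ∑ j, ∑ l ∈ Finset.univ.filter (fun l => l ≠ j), ‖inner ℂ (ψ j) (ψ l)‖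
      ≤ ∑ j, ∑ l ∈ Finset.univ.filter (fun l => l ≠ j), ∑ z, √(a j z) * √(a l z) :=
        Finset.sum_le_sum fun j _ => Finset.sum_le_sum fun l _ => norm_inner_le_sum_sqrt M _ _
    _ = ∑ z, ∑ j, ∑ l ∈ Finset.univ.filter (fun l => l ≠ j), √(a j z) * √(a l z) := by
        rw [Finset.sum_comm]
        exact Finset.sum_congr rfl fun j _ => Finset.sum_comm
    _ ≤ ∑ z, (((n : ℝ) - 2) * ∑ j, a j z + 2 * (√(⨅ x, a x z) * ∑ j, √(a j z))) :=
        Finset.sum_le_sum fun z _ => hz z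
    _ = ((n : ℝ) - 2) * n + 2 * ∑ z, √(⨅ x, a x z) * ∑ j, √(a j z) := by
        rw [Finset.sum_add_distrib, ← Finset.mul_sum, ← Finset.mul_sum, hsum]
    _ ≤ _ := by linarith

end Overlap

/-! ### Quantum values -/

section Quantum

variable {n : ℕ}

lemma uniform_nonneg (x : Fin n) : 0 ≤ uniform n x := by
  unfold uniform
  positivity

lemma quantumAntiDist_term_nonneg {ι : Type} [Fintype ι] [DecidableEq ι] {κ : Type} [Fintype κ]
    {ρ : Fin n → Matrix ι ι ℂ} (hρ : ∀ x, (ρ x).PosSemidef) (M : POVM κ ι) (z : κ) :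
    0 ≤ ⨅ x, uniform n x * bornProb (ρ x) (M.elem z) :=
  Real.iInf_nonneg fun x => mul_nonneg (uniform_nonneg x) (bornProb_nonneg (hρ x) (M.posSemidef z))

lemma le_quantumAntiDist {ι : Type} [Fintype ι] [DecidableEq ι]
    {ρ : Fin n → Matrix ι ι ℂ} (hρ : ∀ x, (ρ x).PosSemidef) {m : ℕ} (M : POVM (Fin m) ι) :
    1 - ∑ z, ⨅ x, uniform n x * bornProb (ρ x) (M.elem z) ≤ quantumAntiDist (uniform n) ρ := by
  refine le_csSup ⟨1, ?_⟩ ⟨m, M, rfl⟩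
  rintro _ ⟨m', M', rfl⟩
  exact sub_le_self _ (Finset.sum_nonneg fun z _ => quantumAntiDist_term_nonneg hρ M' z)

/-- The measurement with a single outcome. -/
noncomputable def trivialPOVM (ι : Type) [Fintype ι] [DecidableEq ι] : POVM (Fin 1) ι where
  elem _ := 1
  posSemidef _ := Matrix.PosSemidef.one
  sum_eq_one := by simp

lemma one_sub_inv_le_quantumAntiDist [NeZero n] {ι : Type} [Fintype ι] [DecidableEq ι]
    {ρ : Fin n → Matrix ι ι ℂ} (hρ : ∀ x, IsDensityMatrix (ρ x)) :
    1 - 1 / (n : ℝ) ≤ quantumAntiDist (uniform n) ρ := by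
  convert le_quantumAntiDist (fun x => (hρ x).1) (trivialPOVM ι) using 2
  simp [trivialPOVM, bornProb, (hρ _).2, uniform]

lemma quantumAntiDist_lt_one [NeZero n] {ι : Type} [Fintype ι] [DecidableEq ι]
    {ψ : Fin n → EuclideanSpace ℂ ι} (hψ : ∀ x, ‖ψ x‖ = 1)
    (h : (n : ℝ) * ((n : ℝ) - 2) <
      ∑ j, ∑ l ∈ Finset.univ.filter (fun l => l ≠ j), ‖inner ℂ (ψ j) (ψ l)‖) :
    quantumAntiDist (uniform n) (fun x => pureState (ψ x)) < 1 := by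
  have hn : (0 : ℝ) < n := by exact_mod_cast Nat.pos_of_neZero n
  set S := ∑ j, ∑ l ∈ Finset.univ.filter (fun l => l ≠ j), ‖inner ℂ (ψ j) (ψ l)‖
  -- `g` is the lower bound on `√δ` obtained by solving `S ≤ n(n - 2) + 2n√δ`. It does not depend on
  -- the measurement, so strictness survives the supremum.
  set g : ℝ := (S - n * (n - 2)) / (2 * n) with hg
  have hg0 : 0 < g := div_pos (by linarith) (by linarith)
  refine lt_of_le_of_lt (b := 1 - g ^ 2 / n) (csSup_le ⟨_, 1, trivialPOVM ι, rfl⟩ ?_)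
    (sub_lt_self _ (by positivity))
  rintro _ ⟨m, M, rfl⟩
  have hle := sum_norm_inner_le_of_povm ψ hψ M
  have h₁ : ∑ z, ⨅ x, uniform n x * bornProb (pureState (ψ x)) (M.elem z) =
      (∑ z, ⨅ x, bornProb (pureState (ψ x)) (M.elem z)) / n := by
    rw [Finset.sum_div]
    refine Finset.sum_congr rfl fun z _ => ?_
    simp only [uniform]
    rw [← Real.mul_iInf_of_nonneg (by positivity)]
    ring
  have h₂ : g ≤ √(∑ z, ⨅ x, bornProb (pureState (ψ x)) (M.elem z)) := by
    rw [hg, div_le_iff₀ (by linarith)]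
    linarith
  rw [h₁]
  have h₃ := (Real.le_sqrt' hg0).1 h₂
  have := div_le_div_of_nonneg_right h₃ hn.le
  linarith

lemma not_antiDistinguishable_of_quantumAntiDist_lt_one {ι : Type} [Fintype ι]
    [DecidableEq ι] {ψ : Fin n → EuclideanSpace ℂ ι}
    (h : quantumAntiDist (uniform n) (fun x => pureState (ψ x)) < 1) :
    ¬ AntiDistinguishable ψ := by
  rintro ⟨M, hM⟩
  have h₁ := le_quantumAntiDist (fun x => posSemidef_pureState (ψ x)) M
  have h₂ : ∑ z, ⨅ x, uniform n x * bornProb (pureState (ψ x)) (M.elem z) ≤ 0 := by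
    refine Finset.sum_nonpos fun z _ => (ciInf_le (Set.finite_range _).bddBelow z).trans ?_
    rw [hM, mul_zero]
  linarith

lemma quantumValues_le_one {N : ℕ} {A s : ℝ} (hs : s ∈ quantumValues N (uniform n) A) : s ≤ 1 := by
  obtain ⟨d, ρ, M, hρ, -, rfl⟩ := hs
  exact sub_le_self _ (Finset.sum_nonneg fun x _ =>
    mul_nonneg (Finset.prod_nonneg fun i _ => uniform_nonneg _)
      (bornProb_nonneg (posSemidef_tensorMatrix fun i => (hρ i (x i)).1) (M.posSemidef x)))

lemma quantumSuccess_eq_one {N : ℕ} {A : ℝ} (h : 1 ∈ quantumValues N (uniform n) A) :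
    quantumSuccess N (uniform n) A = 1 :=
  IsGreatest.csSup_eq ⟨h, fun _ => quantumValues_le_one⟩

lemma one_mem_quantumValues {N d : ℕ} {ψ : Fin n → EuclideanSpace ℂ (Fin d)}
    (hψ : ∀ x, ‖ψ x‖ = 1) (h : AntiDistinguishable (productStates N ψ)) :
    1 ∈ quantumValues N (uniform n)
      (quantumAntiDist (uniform n) (fun x => pureState (ψ x))) := by
  obtain ⟨M, hM⟩ := h
  refine ⟨fun _ => d, fun _ x => pureState (ψ x), M, fun _ x => isDensityMatrix_pureState (hψ x),
    fun _ => le_rfl, ?_⟩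
  rw [Finset.sum_eq_zero, sub_zero]
  intro x _
  rw [tensorMatrix_pureState]
  exact mul_eq_zero_of_right _ (hM x)

/-- Ignoring the state already achieves `1 - 1/n`, so no smaller bound `A` admits any strategy. An
empty set of values has supremum `0` by convention, hence not `1`. This bounds below the set
defining `A^Q`, and for `n ≥ 2` keeps the ratio from dividing by zero. -/
lemma one_sub_inv_le_of_quantumSuccess_eq_one [NeZero n] {N : ℕ} (hN : 1 ≤ N) {A : ℝ}
    (h : quantumSuccess N (uniform n) A = 1) : 1 - 1 / (n : ℝ) ≤ A := by
  have hne : (quantumValues N (uniform n) A).Nonempty := by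
    by_contra hne
    rw [Set.not_nonempty_iff_eq_empty] at hne
    rw [quantumSuccess, hne, Real.sSup_empty] at h
    exact zero_ne_one h
  obtain ⟨_, d, ρ, M, hρ, hA, -⟩ := hne
  exact (one_sub_inv_le_quantumAntiDist (hρ ⟨0, hN⟩)).trans (hA ⟨0, hN⟩)

end Quantum

/-! ### Classical values -/

section Classical

variable {n : ℕ}

lemma classicalValues_le_one {N : ℕ} {A s : ℝ} (hs : s ∈ classicalValues N (uniform n) A) :
    s ≤ 1 := by
  obtain ⟨k, pe, pd, hpe, hpd, -, rfl⟩ := hs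
  exact sub_le_self _ (Finset.sum_nonneg fun x _ =>
    mul_nonneg (Finset.prod_nonneg fun i _ => uniform_nonneg _)
      (Finset.sum_nonneg fun m _ => mul_nonneg ((hpd m).1 x)
        (Finset.prod_nonneg fun i _ => (hpe i (x i)).1 (m i))))

/-- If the inputs of every sender are anti-distinguishable to degree at most `A ≤ 1`, the
receiver errs with probability at least `(1 - A) ^ N`. -/
lemma classicalValues_le {N : ℕ} {A s : ℝ} (hA1 : A ≤ 1)
    (hs : s ∈ classicalValues N (uniform n) A) : s ≤ 1 - (1 - A) ^ N := by
  obtain ⟨k, pe, pd, hpe, hpd, hA, rfl⟩ := hs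
  let c : ∀ i, Fin (k i) → ℝ := fun i m => ⨅ x, uniform n x * pe i x m
  have hc0 : ∀ i m, 0 ≤ c i m := fun i m =>
    Real.iInf_nonneg fun x => mul_nonneg (uniform_nonneg x) ((hpe i x).1 m)
  have hcle : ∀ i m x, c i m ≤ uniform n x * pe i x m := fun i m x =>
    ciInf_le (Set.finite_range _).bddBelow x
  refine sub_le_sub_left ?_ 1
  calc (1 - A) ^ N = ∏ _i : Fin N, (1 - A) := by simp
    _ ≤ ∏ i, ∑ m, c i m := Finset.prod_le_prod (fun i _ => by linarith) fun i _ => by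
        have := hA i
        unfold classicalAntiDist at this
        linarith
    _ = ∑ m : (∀ i, Fin (k i)), ∏ i, c i (m i) := by
        rw [Finset.prod_univ_sum, Fintype.piFinset_univ]
    -- Whatever tuple `x` the decoder names after `m`, the joint weight of `x` and `m` is at least
    -- the product of the minima; averaging over `pd m` costs nothing.
    _ = ∑ m : (∀ i, Fin (k i)), ∑ x, pd m x * ∏ i, c i (m i) := by
        refine Finset.sum_congr rfl fun m _ => ?_
        rw [← Finset.sum_mul, (hpd m).2, one_mul]
    _ ≤ ∑ m : (∀ i, Fin (k i)), ∑ x, pd m x * ∏ i, (uniform n (x i) * pe i (x i) (m i)) :=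
        Finset.sum_le_sum fun m _ => Finset.sum_le_sum fun x _ =>
          mul_le_mul_of_nonneg_left
            (Finset.prod_le_prod (fun i _ => hc0 i _) fun i _ => hcle i _ _) ((hpd m).1 x)
    _ = _ := by
        rw [Finset.sum_comm]
        refine Finset.sum_congr rfl fun x _ => ?_
        rw [Finset.mul_sum]
        refine Finset.sum_congr rfl fun m _ => ?_
        rw [Finset.prod_mul_distrib]
        ring

lemma classicalSuccess_lt_one {N : ℕ} {A : ℝ} (hA : A < 1) :
    classicalSuccess N (uniform n) A < 1 := by
  have hpos : 0 < (1 - A) ^ N := pow_pos (by linarith) N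
  -- The maximum with `0` covers an empty set of values, whose supremum is `0`.
  refine lt_of_le_of_lt (Real.sSup_le (a := max 0 (1 - (1 - A) ^ N)) (fun s hs => ?_)
    (le_max_left _ _)) (max_lt one_pos (by linarith))
  exact (classicalValues_le hA.le hs).trans (le_max_right _ _)

/-- Senders who transmit their inputs allow the receiver to exclude the input with certainty. -/
lemma classicalSuccess_one {N : ℕ} (hN : 1 ≤ N) (hn : 2 ≤ n) :
    classicalSuccess N (uniform n) 1 = 1 := by
  refine IsGreatest.csSup_eq ⟨?_, fun _ => classicalValues_le_one⟩
  have : Nontrivial (Fin n) := Fin.nontrivial_iff_two_le.2 hn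
  choose f hf using fun x : Fin n => exists_ne x
  -- The messages are the inputs themselves, and the receiver names `f (m i) ≠ m i` in every
  -- coordinate; one wrong coordinate, available since `N ≥ 1`, suffices.
  refine ⟨fun _ => n, fun _ x m => if m = x then 1 else 0,
    fun m z => if z = fun i => f (m i) then 1 else 0, fun _ x => ⟨fun m => ?_, by simp⟩,
    fun m => ⟨fun z => ?_, by simp⟩, fun i => ?_, ?_⟩
  · positivity
  · positivity
  · exact sub_le_self _ (Finset.sum_nonneg fun m _ => Real.iInf_nonneg fun x =>
      mul_nonneg (uniform_nonneg x) (by positivity))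
  · rw [Finset.sum_eq_zero, sub_zero]
    intro x _
    refine mul_eq_zero_of_right _ (Finset.sum_eq_zero fun m _ => ?_)
    by_cases hm : m = x
    · subst hm
      refine mul_eq_zero_of_left (if_neg fun h => ?_) _
      exact hf (m ⟨0, hN⟩) (congrFun h ⟨0, hN⟩).symm
    · obtain ⟨i, hi⟩ := Function.ne_iff.1 hm
      exact mul_eq_zero_of_right _ (Finset.prod_eq_zero (Finset.mem_univ i) (if_neg hi))

lemma requiredClassical_one {N : ℕ} (hN : 1 ≤ N) (hn : 2 ≤ n) :
    requiredClassical N (uniform n) 1 = 1 := by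
  refine IsLeast.csInf_eq ⟨classicalSuccess_one hN hn, fun A hA => ?_⟩
  by_contra h
  exact (classicalSuccess_lt_one (N := N) (n := n) (not_le.1 h)).ne hA

end Classical

/-- For `n = 1` the upper bound on `α` is `2^(-1/N) - 1 < 0`. -/
lemma two_le_of_nonneg_of_le {N n : ℕ} {α : ℝ} (hn : n ≠ 0) (hN : 1 ≤ N) (hα : 0 ≤ α)
    (h : α ≤ (n : ℝ) ^ 2 / (2 : ℝ) ^ ((1 : ℝ) / (N : ℝ)) - (n : ℝ)) : 2 ≤ n := by
  have hN' : (0 : ℝ) < N := by exact_mod_cast hN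
  by_contra hlt
  obtain rfl : n = 1 := by omega
  have h1 : (1 : ℝ) < (2 : ℝ) ^ ((1 : ℝ) / (N : ℝ)) :=
    Real.one_lt_rpow one_lt_two (by positivity)
  have := (div_lt_one (by linarith)).2 h1
  norm_num at h
  norm_num at this
  linarith

lemma two_mul_pow_le {N n : ℕ} {α : ℝ} (hN : 1 ≤ N) (hα : 0 ≤ α)
    (h : α ≤ (n : ℝ) ^ 2 / (2 : ℝ) ^ ((1 : ℝ) / (N : ℝ)) - (n : ℝ)) :
    2 * ((n : ℝ) + α) ^ N ≤ ((n : ℝ) ^ N) ^ 2 := by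
  have hle : (n : ℝ) + α ≤ (n : ℝ) ^ 2 / (2 : ℝ) ^ ((1 : ℝ) / (N : ℝ)) := by linarith
  have hpow : ((2 : ℝ) ^ ((1 : ℝ) / (N : ℝ))) ^ N = 2 := by
    rw [one_div]
    exact Real.rpow_inv_natCast_pow zero_le_two (by omega)
  have := pow_le_pow_left₀ (by positivity) hle N
  rw [div_pow, hpow, le_div_iff₀ two_pos] at this
  rw [← pow_mul, mul_comm N 2, pow_mul]
  linarith

end Multipartite

theorem theorem3 (N n d : ℕ) (hN : 1 ≤ N)
    (ψ : Fin n → EuclideanSpace ℂ (Fin d)) (hψ : ∀ x, ‖ψ x‖ = 1)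
    (h₁ : (n : ℝ) * ((n : ℝ) - 2) <
      ∑ j, ∑ l ∈ Finset.univ.filter (fun l => l ≠ j), ‖inner ℂ (ψ j) (ψ l)‖)
    (h₂ : ∑ j, ∑ l ∈ Finset.univ.filter (fun l => l ≠ j), ‖inner ℂ (ψ j) (ψ l)‖ ^ 2 ≤
      (n : ℝ) ^ 2 / (2 : ℝ) ^ ((1 : ℝ) / (N : ℝ)) - (n : ℝ)) :
    -- the states of a single sender are not anti-distinguishable
    ¬ AntiDistinguishable ψ ∧
    quantumAntiDist (uniform n) (fun x => pureState (ψ x)) < 1 ∧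
    -- the Gram matrix of the product states
    gramFrobeniusNorm (productStates N ψ) ^ 2 =
      ((n : ℝ) + ∑ j, ∑ l ∈ Finset.univ.filter (fun l => l ≠ j),
        ‖inner ℂ (ψ j) (ψ l)‖ ^ 2) ^ N ∧
    -- the product states are anti-distinguishable
    AntiDistinguishable (productStates N ψ) ∧
    -- with the senders' anti-distinguishability bounded by that of `ψ`, the optimal quantum success
    -- is `1` and it is attained, while the optimal classical success is smaller
    1 ∈ quantumValues N (uniform n)
      (quantumAntiDist (uniform n) (fun x => pureState (ψ x))) ∧
    quantumSuccess N (uniform n)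
      (quantumAntiDist (uniform n) (fun x => pureState (ψ x))) = 1 ∧
    classicalSuccess N (uniform n)
      (quantumAntiDist (uniform n) (fun x => pureState (ψ x))) < 1 ∧
    -- quantum advantage at success `1`
    requiredClassical N (uniform n) 1 = 1 ∧
    requiredQuantum N (uniform n) 1 < 1 ∧
    1 < (requiredClassical N (uniform n) 1 / requiredQuantum N (uniform n) 1) ^ N := by
  -- For `n = 0` the overlap hypothesis reads `0 < 0`.
  have hn : n ≠ 0 := by
    rintro rfl
    simp at h₁
  have : NeZero n := ⟨hn⟩
  set α := ∑ j, ∑ l ∈ Finset.univ.filter (fun l => l ≠ j), ‖inner ℂ (ψ j) (ψ l)‖ ^ 2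
  have hα : 0 ≤ α := Finset.sum_nonneg fun j _ => Finset.sum_nonneg fun l _ => sq_nonneg _
  have hn2 := two_le_of_nonneg_of_le hn hN hα h₂
  have hsum := sum_sq_norm_inner_productStates N ψ
  rw [sum_sum_eq_card_add_offDiag hψ] at hsum
  have hlt := quantumAntiDist_lt_one hψ h₁
  have hanti : AntiDistinguishable (productStates N ψ) := by
    refine antiDistinguishable_of_two_mul_sum_sq_le _
      (fun x => norm_tensorVec fun i => hψ (x i)) ?_
    rw [hsum]
    simpa using two_mul_pow_le hN hα h₂
  have hmem := one_mem_quantumValues hψ hanti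
  have hC := requiredClassical_one hN hn2
  have hlow : 1 - 1 / (n : ℝ) ≤ requiredQuantum N (uniform n) 1 :=
    le_csInf ⟨_, quantumSuccess_eq_one hmem⟩ fun A hA =>
      one_sub_inv_le_of_quantumSuccess_eq_one hN hA
  have hQ : requiredQuantum N (uniform n) 1 < 1 :=
    lt_of_le_of_lt (csInf_le ⟨_, fun A hA => one_sub_inv_le_of_quantumSuccess_eq_one hN hA⟩
      (quantumSuccess_eq_one hmem)) hlt
  have hpos : 0 < requiredQuantum N (uniform n) 1 := by
    refine lt_of_lt_of_le ?_ hlow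
    have : (1 : ℝ) < n := by exact_mod_cast hn2
    rw [sub_pos, div_lt_one (by linarith)]
    exact this
  refine ⟨not_antiDistinguishable_of_quantumAntiDist_lt_one hlt, hlt,
    (gramFrobeniusNorm_sq _).trans hsum, hanti, hmem, quantumSuccess_eq_one hmem,
    classicalSuccess_lt_one hlt, hC, hQ, one_lt_pow₀ ?_ (by omega)⟩
  rw [hC, one_lt_div hpos]
  exact hQ
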